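/- Let $d\in\mathbb N$ and let $s\neq 0$ be a real number; put $r:=-1/s$. For $a,b\ge 0$ and $\theta\in(0,1)$ let $M_s(a,b;\theta):=\big((1-\theta)a^s+\theta b^s\big)^{1/s}$ if $a,b>0$, and $M_s(a,b;\theta):=0$ if $ab=0$. A probability density $p:\mathbb R^d\to[0,\infty)$ with respect to Lebesgue measure is called $s$-concave if $p\big((1-\theta)x_0+\theta x_1\big)\ge M_s\big(p(x_0),p(x_1);\theta\big)$ for all $x_0,x_1\in\mathbb R^d$ and all $\theta\in(0,1)$. Let $\nu,\nu_1,\nu_2,\ldots$ be probability measures on $\mathbb R^d$ with upper semicontinuous $s$-concave densities $f,f_1,f_2,\ldots$ such that $\nu_n\to\nu$ weakly as $n\to\infty$. Then for every closed set $S\subset\mathbb R^d$ contained in the set of continuity points of $f$ and every real $\kappa<r$, $$\lim_{n\to\infty}\ \sup_{x\in S}\,(1+\|x\|)^{\kappa}\,|f_n(x)-f(x)|=0,$$ where $\|\cdot\|$ is the Euclidean norm (and the supremum over the empty set is $0$). -/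

import Mathlib

open MeasureTheory Filter Topology

/-- The generalized mean `M_s(a, b; θ)` of order `s ∈ ℝ` of two nonnegative numbers `a, b`.
For `s ≠ 0` it is set to `0` as soon as one of the two numbers vanishes. -/
noncomputable def generalizedMean (s a b θ : ℝ) : ℝ :=
  if s = 0 then a ^ (1 - θ) * b ^ θ
  else if a = 0 ∨ b = 0 then 0
  else ((1 - θ) * a ^ s + θ * b ^ s) ^ (1 / s)

/-- `p ((1 - θ) x₀ + θ x₁) ≥ M_s(p x₀, p x₁; θ)` for all `x₀, x₁` and all `θ ∈ (0, 1)`. -/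
def IsSConcave {d : ℕ} (s : ℝ) (p : EuclideanSpace ℝ (Fin d) → ℝ) : Prop :=
  ∀ x₀ x₁ : EuclideanSpace ℝ (Fin d), ∀ θ ∈ Set.Ioo (0 : ℝ) 1,
    generalizedMean s (p x₀) (p x₁) θ ≤ p ((1 - θ) • x₀ + θ • x₁)

/-- `f` is a (nonnegative, real-valued, everywhere defined) Lebesgue density of the measure `ν`. -/
structure IsLebesgueDensity {d : ℕ} (ν : Measure (EuclideanSpace ℝ (Fin d)))
    (f : EuclideanSpace ℝ (Fin d) → ℝ) : Prop where
  nonneg : ∀ x, 0 ≤ f x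
  measurable : Measurable f
  eq_withDensity : ν = volume.withDensity (fun x => ENNReal.ofReal (f x))

/-! Power means increase with their order, so positive `s` reduces to order `-1`. For `s < 0`
superlevel sets are convex, and some ball carries a positive lower bound for all late `fs n`. Weak
convergence then gives three estimates. Below: each small ball contains a point where `fs n` is
large, and convex hulls spread the bound (`eventually_forall_ball_le`). Above: a too large value,
averaged with the good ball, puts too much mass on a small ball (`exists_ball_eventually_lt_add`).
In the tail: a value above the order `‖x‖ ^ s⁻¹` would leave mass far out, against tightness
(`eventually_le_mul_one_add_norm_rpow`). Compactness inside a large ball and decay outside it finish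
the proof. -/

theorem generalizedMean_neg_one_le {s a b θ : ℝ} (hs : 0 < s) (ha : 0 ≤ a) (hb : 0 ≤ b)
    (hθ : θ ∈ Set.Ioo (0 : ℝ) 1) : generalizedMean (-1) a b θ ≤ generalizedMean s a b θ := by
  obtain ⟨h0, h1⟩ := hθ
  unfold generalizedMean
  rw [if_neg (by norm_num), if_neg hs.ne']
  split_ifs with h
  · exact le_rfl
  push Not at h
  have ha' : 0 < a := ha.lt_of_ne' h.1
  have hb' : 0 < b := hb.lt_of_ne' h.2
  have hθ' : 0 < 1 - θ := sub_pos.2 h1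
  trans a ^ (1 - θ) * b ^ θ
  · have key := Real.geom_mean_le_arith_mean2_weighted hθ'.le h0.le (inv_nonneg.2 ha)
      (inv_nonneg.2 hb) (by ring)
    rw [Real.inv_rpow ha, Real.inv_rpow hb, ← mul_inv] at key
    rw [Real.rpow_neg_one, Real.rpow_neg_one, show (1 : ℝ) / -1 = -1 by norm_num,
      Real.rpow_neg_one]
    exact inv_le_of_inv_le₀ (by positivity) key
  · have key := Real.geom_mean_le_arith_mean2_weighted hθ'.le h0.le
      (Real.rpow_nonneg ha s) (Real.rpow_nonneg hb s) (by ring)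
    rw [one_div, Real.le_rpow_inv_iff_of_pos (by positivity) (by positivity) hs]
    convert key using 1
    rw [Real.mul_rpow (by positivity) (by positivity), ← Real.rpow_mul ha, ← Real.rpow_mul hb,
      ← Real.rpow_mul ha, ← Real.rpow_mul hb, mul_comm s, mul_comm s]

/-! ### Convexity and mass bounds for one density -/

section

variable {d : ℕ} {s : ℝ} {p : EuclideanSpace ℝ (Fin d) → ℝ}

theorem IsSConcave.neg_one (hs : 0 < s) (hp : ∀ x, 0 ≤ p x) (h : IsSConcave s p) :
    IsSConcave (-1) p := fun x y θ hθ =>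
  (generalizedMean_neg_one_le hs (hp x) (hp y) hθ).trans (h x y θ hθ)

theorem IsSConcave.rpow_le (h : IsSConcave s p) (hs : s < 0)
    {x y : EuclideanSpace ℝ (Fin d)} {a b θ : ℝ} (ha : 0 < a) (hb : 0 < b) (hx : a ≤ p x)
    (hy : b ≤ p y) (hθ : θ ∈ Set.Ioo (0 : ℝ) 1) :
    ((1 - θ) * a ^ s + θ * b ^ s) ^ s⁻¹ ≤ p ((1 - θ) • x + θ • y) := by
  refine le_trans ?_ (h x y θ hθ)
  have hpx := ha.trans_le hx
  have hpy := hb.trans_le hy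
  obtain ⟨h0, h1⟩ := hθ
  have hθ' : 0 < 1 - θ := sub_pos.2 h1
  rw [generalizedMean, if_neg hs.ne, if_neg (by simp [hpx.ne', hpy.ne']), one_div]
  refine Real.rpow_le_rpow_of_nonpos (by positivity) ?_ (inv_neg''.2 hs).le
  gcongr 2
  · exact Real.rpow_le_rpow_of_nonpos ha hx hs.le
  · exact Real.rpow_le_rpow_of_nonpos hb hy hs.le

theorem IsSConcave.convex_superlevel (h : IsSConcave s p) (hs : s < 0) {m : ℝ} (hm : 0 < m) :
    Convex ℝ {x | m ≤ p x} := by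
  rw [convex_iff_forall_pos]
  intro x hx y hy a b ha hb hab
  have := h.rpow_le hs hm hm hx hy (θ := b) ⟨hb, by linarith⟩
  rw [← add_mul, sub_add_cancel, one_mul, Real.rpow_rpow_inv hm.le hs.ne] at this
  rwa [eq_sub_of_add_eq hab]

variable {ν : Measure (EuclideanSpace ℝ (Fin d))} {B : Set (EuclideanSpace ℝ (Fin d))}

theorem IsLebesgueDensity.measure_le (h : IsLebesgueDensity ν p) (hB : MeasurableSet B) {M : ℝ}
    (hM : ∀ x ∈ B, p x ≤ M) : ν B ≤ ENNReal.ofReal M * volume B := by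
  rw [h.eq_withDensity, withDensity_apply _ hB, ← setLIntegral_const]
  exact setLIntegral_mono' hB fun x hx => ENNReal.ofReal_le_ofReal (hM x hx)

theorem IsLebesgueDensity.le_measure (h : IsLebesgueDensity ν p) (hB : MeasurableSet B) {M : ℝ}
    (hM : ∀ x ∈ B, M ≤ p x) : ENNReal.ofReal M * volume B ≤ ν B := by
  rw [h.eq_withDensity, withDensity_apply _ hB, ← setLIntegral_const]
  exact setLIntegral_mono' hB fun x hx => ENNReal.ofReal_le_ofReal (hM x hx)

/-- Otherwise every set `{1 / (n + 1) ≤ p}` is convex with empty interior, hence lies in its own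
null frontier, and `p = 0` almost everywhere. -/
theorem IsLebesgueDensity.exists_ball_le (h : IsLebesgueDensity ν p) [NeZero ν]
    (hc : IsSConcave s p) (hs : s < 0) :
    ∃ c > 0, ∃ a, ∃ r > 0, ∀ x ∈ Metric.ball a r, c ≤ p x := by
  by_contra! hcon
  apply NeZero.ne ν
  rw [h.eq_withDensity, withDensity_eq_zero_iff h.measurable.ennreal_ofReal.aemeasurable]
  have key : ∀ n : ℕ, ∀ᵐ x, ¬ (1 / ((n : ℝ) + 1) ≤ p x) := by
    intro n
    rw [ae_iff]
    simp only [not_not]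
    have hn : 0 < 1 / ((n : ℝ) + 1) := by positivity
    have hconv := hc.convex_superlevel hs hn
    have hint : interior {x | 1 / ((n : ℝ) + 1) ≤ p x} = ∅ := by
      rw [Set.eq_empty_iff_forall_notMem]
      intro a ha
      obtain ⟨r, hr, hsub⟩ := Metric.isOpen_iff.1 isOpen_interior a ha
      obtain ⟨x, hx, hlt⟩ := hcon _ hn a r hr
      exact absurd (interior_subset (hsub hx)) (not_le.2 hlt)
    refine measure_mono_null ?_ (hconv.addHaar_frontier volume)
    rw [frontier, hint, Set.sdiff_empty]
    exact subset_closure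
  filter_upwards [ae_all_iff.2 key] with x hx
  simp only [Pi.zero_apply, ENNReal.ofReal_eq_zero]
  by_contra! hpos
  obtain ⟨n, hn⟩ := exists_nat_one_div_lt hpos
  exact hx n hn.le

end

/-! ### Geometric lemmas on balls and convex hulls -/

section

variable {d : ℕ} {s : ℝ} {p : EuclideanSpace ℝ (Fin d) → ℝ}

theorem IsSConcave.rpow_le_of_mem_ball (h : IsSConcave s p) (hs : s < 0)
    {z y w : EuclideanSpace ℝ (Fin d)} {c t r θ : ℝ} (hc : 0 < c) (ht : 0 < t)
    (hz : ∀ x ∈ Metric.ball z r, c ≤ p x) (hy : t ≤ p y) (hθ : θ ∈ Set.Ioo (0 : ℝ) 1)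
    (hw : w ∈ Metric.ball ((1 - θ) • z + θ • y) ((1 - θ) * r)) :
    ((1 - θ) * c ^ s + θ * t ^ s) ^ s⁻¹ ≤ p w := by
  have hθ' : 0 < 1 - θ := sub_pos.2 hθ.2
  have hx : (1 - θ)⁻¹ • (w - θ • y) ∈ Metric.ball z r := by
    rw [mem_ball_iff_norm] at hw ⊢
    have : (1 - θ)⁻¹ • (w - θ • y) - z = (1 - θ)⁻¹ • (w - ((1 - θ) • z + θ • y)) := by
      rw [sub_add_eq_sub_sub_swap, smul_sub _ (w - θ • y), inv_smul_smul₀ hθ'.ne']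
    rw [this, norm_smul, Real.norm_of_nonneg (inv_nonneg.2 hθ'.le), inv_mul_lt_iff₀ hθ']
    exact hw
  have := h.rpow_le hs hc ht (hz _ hx) hy hθ
  rwa [smul_inv_smul₀ hθ'.ne', sub_add_cancel] at this

/-- If `T` is `2r`-dense in the closed ball of radius `4r` about `x₀`, then its convex hull contains
the ball of radius `r` about `x₀`. -/
theorem mem_convexHull_of_forall_exists_dist_lt {E : Type*} [NormedAddCommGroup E]
    [InnerProductSpace ℝ E] [CompleteSpace E] {T : Set E} (hT : T.Finite) {x₀ x : E} {r : ℝ}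
    (hr : 0 < r) (h : ∀ z ∈ Metric.closedBall x₀ (4 * r), ∃ y ∈ T, dist z y < 2 * r)
    (hx : x ∈ Metric.ball x₀ r) : x ∈ convexHull ℝ T := by
  by_contra hcon
  obtain ⟨φ, u, hφx, hφ⟩ := geometric_hahn_banach_point_closed (convex_convexHull ℝ T)
    (hT.isClosed_convexHull (𝕜 := ℝ)) hcon
  set v := (InnerProductSpace.toDual ℝ E).symm φ with hv
  have hφv : ∀ y, φ y = inner ℝ v y := fun y => by
    rw [hv, InnerProductSpace.toDual_symm_apply]
  -- Going `4r` against the separating direction lowers `φ` by `4r‖v‖`; a point of `T` within `2r`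
  -- regains at most `2r‖v‖`, while `φ x` is at most `r‖v‖` below `φ x₀`.
  have hz : x₀ - (4 * r * ‖v‖⁻¹) • v ∈ Metric.closedBall x₀ (4 * r) := by
    rw [mem_closedBall_iff_norm, sub_sub_cancel_left, norm_neg, norm_smul, Real.norm_of_nonneg
      (by positivity), mul_assoc]
    exact mul_le_of_le_one_right (by positivity) inv_mul_le_one
  obtain ⟨y, hyT, hy⟩ := h _ hz
  have hlt : φ x < φ y := hφx.trans (hφ y (subset_convexHull ℝ T hyT))
  set z := x₀ - (4 * r * ‖v‖⁻¹) • v with hzdef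
  have h1 : φ (y - z) ≤ ‖v‖ * (2 * r) := by
    rw [hφv]
    refine (real_inner_le_norm _ _).trans ?_
    rw [dist_comm, dist_eq_norm] at hy
    gcongr
  have h2 : φ (x₀ - x) ≤ ‖v‖ * r := by
    rw [hφv]
    refine (real_inner_le_norm _ _).trans ?_
    rw [mem_ball_iff_norm'] at hx
    gcongr
  have h3 : φ z = φ x₀ - 4 * r * ‖v‖ := by
    rw [hzdef, map_sub, map_smul, hφv v, real_inner_self_eq_norm_sq, smul_eq_mul]
    rcases eq_or_ne ‖v‖ 0 with h0 | h0
    · simp [h0]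
    · field_simp
  rw [map_sub] at h1 h2
  nlinarith [norm_nonneg v]

end

/-! ### Local bounds from weak convergence -/

section

variable {d : ℕ} {s : ℝ} {ν : ProbabilityMeasure (EuclideanSpace ℝ (Fin d))}
  {νs : ℕ → ProbabilityMeasure (EuclideanSpace ℝ (Fin d))}
  {f : EuclideanSpace ℝ (Fin d) → ℝ} {fs : ℕ → EuclideanSpace ℝ (Fin d) → ℝ}

theorem eventually_exists_lt_of_isOpen
    (hf : IsLebesgueDensity (ν : Measure (EuclideanSpace ℝ (Fin d))) f)
    (hfs : ∀ n, IsLebesgueDensity (νs n : Measure (EuclideanSpace ℝ (Fin d))) (fs n))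
    (hweak : Tendsto νs atTop (𝓝 ν)) {U : Set (EuclideanSpace ℝ (Fin d))} (hU : IsOpen U)
    (hne : U.Nonempty) (hfin : volume U ≠ ⊤) {m m' : ℝ} (hm : 0 < m) (hmm : m' < m)
    (hfm : ∀ x ∈ U, m ≤ f x) : ∀ᶠ n in atTop, ∃ x ∈ U, m' < fs n x := by
  have h1 : ENNReal.ofReal m' * volume U < (ν : Measure _) U := by
    refine lt_of_lt_of_le ?_ (hf.le_measure hU.measurableSet hfm)
    exact ENNReal.mul_lt_mul_left (hU.measure_pos volume hne).ne' hfin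
      ((ENNReal.ofReal_lt_ofReal_iff hm).2 hmm)
  have h2 := h1.trans_le (ProbabilityMeasure.le_liminf_measure_open_of_tendsto hweak hU)
  filter_upwards [eventually_lt_of_lt_liminf h2] with n hn
  by_contra! hcon
  exact absurd hn (not_lt.2 ((hfs n).measure_le hU.measurableSet hcon))

/-- A strict lower bound for the limit density on a ball is inherited by the approximating
densities on a smaller ball. -/
theorem eventually_forall_ball_le (hs : s < 0)
    (hf : IsLebesgueDensity (ν : Measure (EuclideanSpace ℝ (Fin d))) f)
    (hfs : ∀ n, IsLebesgueDensity (νs n : Measure (EuclideanSpace ℝ (Fin d))) (fs n))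
    (hfsc : ∀ n, IsSConcave s (fs n))
    (hweak : Tendsto νs atTop (𝓝 ν)) {x₀ : EuclideanSpace ℝ (Fin d)} {m m' r : ℝ} (hm' : 0 < m')
    (hmm : m' < m) (hr : 0 < r) (hfm : ∀ x ∈ Metric.ball x₀ (5 * r), m ≤ f x) :
    ∀ᶠ n in atTop, ∀ x ∈ Metric.ball x₀ r, m' ≤ fs n x := by
  obtain ⟨t, ht, hcov⟩ := (isCompact_closedBall x₀ (4 * r)).elim_nhds_subcover
    (fun z => Metric.ball z r) (fun z _ => Metric.ball_mem_nhds z hr)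
  have key : ∀ᶠ n in atTop, ∀ z ∈ t, ∃ x ∈ Metric.ball z r, m' < fs n x := by
    rw [eventually_all_finset]
    intro z hz
    refine eventually_exists_lt_of_isOpen hf hfs hweak Metric.isOpen_ball
      (Metric.nonempty_ball.2 hr) measure_ball_lt_top.ne (hm'.trans hmm) hmm
      fun x hx => hfm x (Metric.ball_subset_ball' ?_ hx)
    have := Metric.mem_closedBall.1 (ht z hz)
    linarith
  filter_upwards [key] with n hn x hx
  choose! y hy using hn
  have hmem : x ∈ convexHull ℝ (y '' t) := by
    refine mem_convexHull_of_forall_exists_dist_lt (t.finite_toSet.image y) hr (fun z hz => ?_) hx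
    obtain ⟨w, hw, hzw⟩ := Set.mem_iUnion₂.1 (hcov hz)
    refine ⟨y w, Set.mem_image_of_mem y hw, (dist_triangle_right z (y w) w).trans_lt ?_⟩
    have h1 := Metric.mem_ball.1 (hy w hw).1
    have h2 := Metric.mem_ball.1 hzw
    linarith
  refine convexHull_min ?_ ((hfsc n).convex_superlevel hs hm') hmem
  rintro _ ⟨w, hw, rfl⟩
  exact (hy w hw).2.le

theorem exists_ball_eventually_le (hs : s < 0)
    (hf : IsLebesgueDensity (ν : Measure (EuclideanSpace ℝ (Fin d))) f) (hfc : IsSConcave s f)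
    (hfs : ∀ n, IsLebesgueDensity (νs n : Measure (EuclideanSpace ℝ (Fin d))) (fs n))
    (hfsc : ∀ n, IsSConcave s (fs n)) (hweak : Tendsto νs atTop (𝓝 ν)) :
    ∃ c > 0, ∃ a, ∃ r > 0, ∀ᶠ n in atTop, ∀ x ∈ Metric.ball a r, c ≤ fs n x := by
  have : NeZero (ν : Measure (EuclideanSpace ℝ (Fin d))) := ⟨IsProbabilityMeasure.ne_zero _⟩
  obtain ⟨c, hc, a, r, hr, h⟩ := hf.exists_ball_le hfc hs
  exact ⟨c / 2, half_pos hc, a, r / 5, by positivity, eventually_forall_ball_le hs hf hfs hfsc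
    hweak (half_pos hc) (half_lt_self hc) (by positivity) (by rwa [mul_div_cancel₀ _ (by simp)])⟩

theorem exists_ball_eventually_lt_add (hs : s < 0)
    (hf : IsLebesgueDensity (ν : Measure (EuclideanSpace ℝ (Fin d))) f) (hfc : IsSConcave s f)
    (husc : UpperSemicontinuous f)
    (hfs : ∀ n, IsLebesgueDensity (νs n : Measure (EuclideanSpace ℝ (Fin d))) (fs n))
    (hfsc : ∀ n, IsSConcave s (fs n)) (hweak : Tendsto νs atTop (𝓝 ν))
    (x₀ : EuclideanSpace ℝ (Fin d)) {ε : ℝ} (hε : 0 < ε) :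
    ∃ ρ > 0, ∀ᶠ n in atTop, ∀ x ∈ Metric.ball x₀ ρ, fs n x < f x₀ + ε := by
  obtain ⟨c, hc, a, r, hr, hlow⟩ := exists_ball_eventually_le hs hf hfc hfs hfsc hweak
  have hx₀ := hf.nonneg x₀
  have ht : 0 < f x₀ + ε := by positivity
  obtain ⟨η, hη, hball⟩ := Metric.eventually_nhds_iff_ball.1
    (husc x₀ (f x₀ + ε / 4) (by linarith))
  have lim1 : Tendsto (fun θ : ℝ => ((1 - θ) * c ^ s + θ * (f x₀ + ε) ^ s) ^ s⁻¹) (𝓝 1)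
      (𝓝 (f x₀ + ε)) := by
    have h1 : Tendsto (fun θ : ℝ => (1 - θ) * c ^ s + θ * (f x₀ + ε) ^ s) (𝓝 1)
        (𝓝 ((f x₀ + ε) ^ s)) := by
      have : Continuous (fun θ : ℝ => (1 - θ) * c ^ s + θ * (f x₀ + ε) ^ s) := by fun_prop
      simpa using this.tendsto 1
    have h2 := h1.rpow_const (p := s⁻¹) (Or.inl (Real.rpow_pos_of_pos ht s).ne')
    rwa [Real.rpow_rpow_inv ht.le hs.ne] at h2
  have lim2 : Tendsto (fun θ : ℝ => (1 - θ) * (dist a x₀ + r / 2)) (𝓝 1) (𝓝 0) := by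
    have : Continuous (fun θ : ℝ => (1 - θ) * (dist a x₀ + r / 2)) := by fun_prop
    simpa using this.tendsto 1
  -- As `θ → 1` the mean tends to the assumed large value and the contracted ball shrinks to `x₀`;
  -- `θ < 1` keeps its radius positive.
  have ev : ∀ᶠ θ : ℝ in 𝓝[<] 1,
      f x₀ + ε / 2 < ((1 - θ) * c ^ s + θ * (f x₀ + ε) ^ s) ^ s⁻¹ ∧
        (1 - θ) * (dist a x₀ + r / 2) < η ∧ θ ∈ Set.Ioo (0 : ℝ) 1 :=
    ((lim1.eventually_const_lt (by linarith)).filter_mono nhdsWithin_le_nhds).and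
      (((lim2.eventually_lt_const hη).filter_mono nhdsWithin_le_nhds).and
        (Ioo_mem_nhdsLT one_pos))
  obtain ⟨θ, hθm, hθη, hθ⟩ := ev.exists
  have hθ' : 0 < 1 - θ := sub_pos.2 hθ.2
  -- Half the available radius is kept back to absorb moving the centre from `x₀` to a nearby `x`,
  -- so `B` does not depend on `x` or `n`.
  set B := Metric.closedBall ((1 - θ) • a + θ • x₀) ((1 - θ) * (r / 2)) with hB
  have hrad : 0 < (1 - θ) * (r / 2) := by positivity
  have hBf : ∀ x ∈ B, f x ≤ f x₀ + ε / 4 := by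
    intro x hx
    refine (hball x ?_).le
    have h1 : dist ((1 - θ) • a + θ • x₀) x₀ = (1 - θ) * dist a x₀ := by
      rw [dist_eq_norm, dist_eq_norm, ← Real.norm_of_nonneg hθ'.le, ← norm_smul,
        Real.norm_of_nonneg hθ'.le]
      congr 1
      module
    have h2 := dist_triangle x ((1 - θ) • a + θ • x₀) x₀
    have h3 := Metric.mem_closedBall.1 hx
    rw [Metric.mem_ball]
    linarith
  have hνB : (ν : Measure _) B < ENNReal.ofReal (f x₀ + ε / 2) * volume B := by
    refine (hf.measure_le Metric.isClosed_closedBall.measurableSet hBf).trans_lt ?_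
    exact ENNReal.mul_lt_mul_left (Metric.measure_closedBall_pos volume _ hrad).ne'
      measure_closedBall_lt_top.ne
      ((ENNReal.ofReal_lt_ofReal_iff (by positivity)).2 (by linarith))
  have hlim := (ProbabilityMeasure.limsup_measure_closed_le_of_tendsto hweak
    (Metric.isClosed_closedBall : IsClosed B)).trans_lt hνB
  refine ⟨(1 - θ) * (r / 2), hrad, ?_⟩
  filter_upwards [hlow, eventually_lt_of_limsup_lt hlim] with n hn hnB x hx
  by_contra! hcon
  refine absurd hnB (not_lt.2 ((hfs n).le_measure Metric.isClosed_closedBall.measurableSet ?_))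
  intro w hw
  refine hθm.le.trans ((hfsc n).rpow_le_of_mem_ball hs hc ht hn hcon hθ ?_)
  have h1 : dist ((1 - θ) • a + θ • x₀) ((1 - θ) • a + θ • x) = θ * dist x x₀ := by
    rw [dist_add_left, dist_smul₀, Real.norm_of_nonneg hθ.1.le, dist_comm]
  have h2 := dist_triangle w ((1 - θ) • a + θ • x₀) ((1 - θ) • a + θ • x)
  have h3 := Metric.mem_closedBall.1 hw
  have h4 : θ * dist x x₀ ≤ dist x x₀ := mul_le_of_le_one_left dist_nonneg hθ.2.le
  rw [Metric.mem_ball] at hx ⊢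
  linarith

/-! ### Uniform tail bound -/

theorem eventually_le_mul_one_add_norm_rpow (hs : s < 0)
    (hf : IsLebesgueDensity (ν : Measure (EuclideanSpace ℝ (Fin d))) f) (hfc : IsSConcave s f)
    (hfs : ∀ n, IsLebesgueDensity (νs n : Measure (EuclideanSpace ℝ (Fin d))) (fs n))
    (hfsc : ∀ n, IsSConcave s (fs n)) (hweak : Tendsto νs atTop (𝓝 ν)) :
    ∃ C R : ℝ, ∀ᶠ n in atTop, ∀ x, R ≤ ‖x‖ → fs n x ≤ C * (1 + ‖x‖) ^ s⁻¹ := by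
  obtain ⟨c, hc, a, r, hr, hlow⟩ := exists_ball_eventually_le hs hf hfc hfs hfsc hweak
  have hcs : 0 < c ^ s := Real.rpow_pos_of_pos hc s
  set c' := (2 * c ^ s) ^ s⁻¹ with hc'
  have hc'0 : 0 < c' := by positivity
  set V := volume (Metric.ball (0 : EuclideanSpace ℝ (Fin d)) (r / 2)) with hV
  have hV0 : 0 < V := Metric.measure_ball_pos _ _ (half_pos hr)
  have htight := tendsto_measure_compl_closedBall_of_isTightMeasureSet
    (isTightMeasureSet_singleton (μ := (ν : Measure (EuclideanSpace ℝ (Fin d))))) a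
  simp only [Set.mem_singleton_iff, iSup_iSup_eq_left] at htight
  obtain ⟨L, hL, hL0⟩ := ((htight.eventually_lt_const (u := ENNReal.ofReal c' * V)
    (ENNReal.mul_pos (ENNReal.ofReal_pos.2 hc'0).ne' hV0.ne')).and (eventually_ge_atTop 0)).exists
  have hF : IsClosed (Metric.ball a (L + 1))ᶜ := Metric.isOpen_ball.isClosed_compl
  have hνF : (ν : Measure _) (Metric.ball a (L + 1))ᶜ < ENNReal.ofReal c' * V :=
    (measure_mono (Set.compl_subset_compl.2
      (Metric.closedBall_subset_ball (lt_add_one L)))).trans_lt hL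
  have hlim := (ProbabilityMeasure.limsup_measure_closed_le_of_tendsto hweak hF).trans_lt hνF
  set K := L + 1 + r with hK
  have hK0 : 0 < K := by positivity
  -- The threshold makes `dist x a ≥ 2 * K`, whence `θ ≤ 1 / 2` below, and `1 + ‖x‖ ≤ 2 * dist x a`.
  refine ⟨(c ^ s / (2 * K)) ^ s⁻¹, 2 * ‖a‖ + 1 + 2 * K, ?_⟩
  filter_upwards [hlow, eventually_lt_of_limsup_lt hlim] with n hn hnF x hx
  rcases ((hfs n).nonneg x).eq_or_lt with h0 | hpos
  · rw [← h0]
    positivity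
  have hxa : ‖x‖ - ‖a‖ ≤ dist x a := by
    rw [dist_eq_norm]
    exact norm_sub_norm_le x a
  have ha := norm_nonneg a
  have hD : 0 < dist x a := by linarith
  have key : c ^ s * dist x a / K ≤ fs n x ^ s := by
    by_contra! hcon
    -- This puts the averaged point at distance exactly `K` from `a`, where a ball of radius `r / 2`
    -- still misses `ball a (L + 1)`.
    set θ := K / dist x a with hθ
    have hθ0 : 0 < θ := by positivity
    have hθ2 : θ ≤ 1 / 2 := by
      rw [hθ, div_le_iff₀ hD]
      linarith
    have hz : dist ((1 - θ) • a + θ • x) a = K := by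
      rw [dist_eq_norm, show (1 - θ) • a + θ • x - a = θ • (x - a) by module, norm_smul,
        Real.norm_of_nonneg hθ0.le, ← dist_eq_norm, hθ, div_mul_cancel₀ _ hD.ne']
    have hsub : Metric.ball ((1 - θ) • a + θ • x) (r / 2) ⊆ (Metric.ball a (L + 1))ᶜ := by
      intro w hw hwa
      rw [Metric.mem_ball] at hw hwa
      have := dist_triangle_left ((1 - θ) • a + θ • x) a w
      linarith
    have hlb : ∀ w ∈ Metric.ball ((1 - θ) • a + θ • x) (r / 2), c' ≤ fs n w := by
      intro w hw
      refine le_trans ?_ ((hfsc n).rpow_le_of_mem_ball hs hc hpos hn le_rfl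
        ⟨hθ0, by linarith⟩ (Metric.ball_subset_ball (by nlinarith) hw))
      have h1 : θ * fs n x ^ s ≤ c ^ s := by
        calc θ * fs n x ^ s ≤ θ * (c ^ s * dist x a / K) := by gcongr
          _ = c ^ s := by rw [hθ]; field_simp
      have h1θ : 0 < 1 - θ := by linarith
      refine Real.rpow_le_rpow_of_nonpos (by positivity) ?_ (inv_neg''.2 hs).le
      nlinarith
    have := ((hfs n).le_measure Metric.isOpen_ball.measurableSet hlb).trans (measure_mono hsub)
    rw [Measure.addHaar_ball_center] at this
    exact absurd hnF (not_lt.2 this)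
  rw [← Real.mul_rpow (by positivity) (by positivity), Real.le_rpow_inv_iff_of_neg hpos
    (by positivity) hs]
  refine le_trans ?_ key
  rw [div_mul_eq_mul_div, div_le_div_iff₀ (by positivity) hK0]
  have : 1 + ‖x‖ ≤ 2 * dist x a := by linarith
  calc c ^ s * (1 + ‖x‖) * K ≤ c ^ s * (2 * dist x a) * K := by gcongr
    _ = _ := by ring

/-! ### From local to weighted uniform convergence -/

theorem exists_ball_eventually_abs_sub_lt (hs : s < 0)
    (hf : IsLebesgueDensity (ν : Measure (EuclideanSpace ℝ (Fin d))) f) (hfc : IsSConcave s f)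
    (husc : UpperSemicontinuous f)
    (hfs : ∀ n, IsLebesgueDensity (νs n : Measure (EuclideanSpace ℝ (Fin d))) (fs n))
    (hfsc : ∀ n, IsSConcave s (fs n)) (hweak : Tendsto νs atTop (𝓝 ν))
    {x₀ : EuclideanSpace ℝ (Fin d)} (hcont : ContinuousAt f x₀) {ε : ℝ} (hε : 0 < ε) :
    ∃ U ∈ 𝓝 x₀, ∀ᶠ n in atTop, ∀ x ∈ U, |fs n x - f x| < ε := by
  obtain ⟨ρ, hρ, hup⟩ := exists_ball_eventually_lt_add hs hf hfc husc hfs hfsc hweak x₀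
    (half_pos hε)
  have hlow : ∃ ρ' > 0, ∀ᶠ n in atTop, ∀ x ∈ Metric.ball x₀ ρ', f x₀ - ε / 2 ≤ fs n x := by
    rcases le_or_gt (f x₀ - ε / 2) 0 with h0 | h0
    · exact ⟨1, one_pos, Eventually.of_forall fun n x _ => h0.trans ((hfs n).nonneg x)⟩
    obtain ⟨η, hη, hball⟩ := Metric.eventually_nhds_iff_ball.1
      (hcont.eventually_const_lt (show f x₀ - ε / 4 < f x₀ by linarith))
    refine ⟨η / 5, by positivity, eventually_forall_ball_le (m := f x₀ - ε / 4) hs hf hfs hfsc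
      hweak h0 (by linarith) (by positivity) ?_⟩
    rw [mul_div_cancel₀ _ (by simp)]
    exact fun x hx => (hball x hx).le
  obtain ⟨ρ', hρ', hlow⟩ := hlow
  have hnear : {x | dist (f x) (f x₀) < ε / 2} ∈ 𝓝 x₀ :=
    hcont (Metric.ball_mem_nhds _ (half_pos hε))
  refine ⟨_, inter_mem (inter_mem (Metric.ball_mem_nhds x₀ hρ) (Metric.ball_mem_nhds x₀ hρ'))
    hnear, ?_⟩
  filter_upwards [hup, hlow] with n h1 h2 x hx
  have h3 := h1 x hx.1.1
  have h4 := h2 x hx.1.2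
  have h5 := abs_lt.1 (Real.dist_eq _ _ ▸ hx.2 : |f x - f x₀| < ε / 2)
  rw [abs_lt]
  constructor <;> linarith

theorem eventually_forall_abs_sub_lt_of_isCompact (hs : s < 0)
    (hf : IsLebesgueDensity (ν : Measure (EuclideanSpace ℝ (Fin d))) f) (hfc : IsSConcave s f)
    (husc : UpperSemicontinuous f)
    (hfs : ∀ n, IsLebesgueDensity (νs n : Measure (EuclideanSpace ℝ (Fin d))) (fs n))
    (hfsc : ∀ n, IsSConcave s (fs n)) (hweak : Tendsto νs atTop (𝓝 ν))
    {K : Set (EuclideanSpace ℝ (Fin d))} (hK : IsCompact K)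
    (hcont : ∀ x ∈ K, ContinuousAt f x) {ε : ℝ} (hε : 0 < ε) :
    ∀ᶠ n in atTop, ∀ x ∈ K, |fs n x - f x| < ε := by
  refine hK.induction_on (p := fun A => ∀ᶠ n in atTop, ∀ x ∈ A, |fs n x - f x| < ε) (by simp)
    (fun A B hAB hB => hB.mono fun n hn x hx => hn x (hAB hx))
    (fun A B hA hB => ?_) fun x hx => ?_
  · filter_upwards [hA, hB] with n h1 h2 x hx
    exact hx.elim (h1 x) (h2 x)
  · obtain ⟨U, hU, h⟩ := exists_ball_eventually_abs_sub_lt hs hf hfc husc hfs hfsc hweak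
      (hcont x hx) hε
    exact ⟨U, mem_nhdsWithin_of_mem_nhds hU, h⟩

theorem eventually_forall_weighted_abs_sub_le (hs : s < 0)
    (hf : IsLebesgueDensity (ν : Measure (EuclideanSpace ℝ (Fin d))) f) (hfc : IsSConcave s f)
    (husc : UpperSemicontinuous f)
    (hfs : ∀ n, IsLebesgueDensity (νs n : Measure (EuclideanSpace ℝ (Fin d))) (fs n))
    (hfsc : ∀ n, IsSConcave s (fs n)) (hweak : Tendsto νs atTop (𝓝 ν))
    {S : Set (EuclideanSpace ℝ (Fin d))} (hS : IsClosed S)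
    (hcont : ∀ x ∈ S, ContinuousAt f x) {κ : ℝ} (hκ : κ < -1 / s) {ε : ℝ} (hε : 0 < ε) :
    ∀ᶠ n in atTop, ∀ x ∈ S, (1 + ‖x‖) ^ κ * |fs n x - f x| ≤ ε := by
  obtain ⟨C₁, R₁, h₁⟩ := eventually_le_mul_one_add_norm_rpow hs hf hfc hfs hfsc hweak
  -- The constant sequence gives the tail bound for `f` itself.
  obtain ⟨C₂, R₂, h₂⟩ := eventually_le_mul_one_add_norm_rpow hs hf hfc (fun _ => hf)
    (fun _ => hfc) (tendsto_const_nhds (x := ν) (f := (atTop : Filter ℕ)))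
  replace h₂ := h₂.exists.choose_spec
  have hexp : κ + s⁻¹ < 0 := by
    rw [neg_div, one_div] at hκ
    linarith
  have hdecay : Tendsto (fun u : ℝ => (|C₁| + |C₂|) * (1 + u) ^ (κ + s⁻¹)) atTop (𝓝 0) := by
    have h := ((tendsto_rpow_neg_atTop (neg_pos.2 hexp)).comp
      (tendsto_atTop_add_const_left atTop (1 : ℝ) tendsto_id)).const_mul (|C₁| + |C₂|)
    simpa [Function.comp_def] using h
  obtain ⟨R₀, hR₀⟩ := eventually_atTop.1 (hdecay.eventually_le_const hε)
  set R := max (max R₀ 0) (max R₁ R₂) with hR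
  have hR0 : 0 ≤ R := (le_max_right _ _).trans (le_max_left _ _)
  -- The absolute value bounds the weight on the ball for either sign of `κ`.
  have hW : 0 < (1 + R) ^ |κ| := by positivity
  have hcpt := eventually_forall_abs_sub_lt_of_isCompact hs hf hfc husc hfs hfsc hweak
    ((isCompact_closedBall 0 R).inter_left hS) (fun x hx => hcont x hx.1) (div_pos hε hW)
  filter_upwards [h₁, hcpt] with n hn hnc x hxS
  rcases le_total ‖x‖ R with hxR | hxR
  · have h3 := (hnc x ⟨hxS, mem_closedBall_zero_iff.2 hxR⟩).le
    have h4 : (1 + ‖x‖) ^ κ ≤ (1 + R) ^ |κ| :=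
      (Real.rpow_le_rpow_of_exponent_le (by linarith [norm_nonneg x]) (le_abs_self κ)).trans
        (Real.rpow_le_rpow (by positivity) (by linarith) (abs_nonneg κ))
    calc (1 + ‖x‖) ^ κ * |fs n x - f x| ≤ (1 + R) ^ |κ| * (ε / (1 + R) ^ |κ|) := by gcongr
      _ = ε := mul_div_cancel₀ _ hW.ne'
  · have hx1 : 0 < 1 + ‖x‖ := by positivity
    have hpw : 0 < (1 + ‖x‖) ^ s⁻¹ := by positivity
    have h3 := hn x (((le_max_left _ _).trans (le_max_right _ _)).trans hxR)
    have h4 := h₂ x (((le_max_right _ _).trans (le_max_right _ _)).trans hxR)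
    have h5 : |fs n x - f x| ≤ (|C₁| + |C₂|) * (1 + ‖x‖) ^ s⁻¹ := by
      have h6 := mul_le_mul_of_nonneg_right (le_abs_self C₁) hpw.le
      have h7 := mul_le_mul_of_nonneg_right (le_abs_self C₂) hpw.le
      have h8 := (hfs n).nonneg x
      have h9 := hf.nonneg x
      rw [abs_le, add_mul]
      constructor <;> linarith
    calc (1 + ‖x‖) ^ κ * |fs n x - f x|
        ≤ (1 + ‖x‖) ^ κ * ((|C₁| + |C₂|) * (1 + ‖x‖) ^ s⁻¹) := by gcongr
      _ = (|C₁| + |C₂|) * (1 + ‖x‖) ^ (κ + s⁻¹) := by rw [Real.rpow_add hx1]; ring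
      _ ≤ ε := hR₀ _ (((le_max_left _ _).trans (le_max_left _ _)).trans hxR)

end

theorem mainTheorem11 {d : ℕ} (s : ℝ) (hs : s ≠ 0)
    (ν : ProbabilityMeasure (EuclideanSpace ℝ (Fin d)))
    (νs : ℕ → ProbabilityMeasure (EuclideanSpace ℝ (Fin d)))
    (f : EuclideanSpace ℝ (Fin d) → ℝ)
    (fs : ℕ → EuclideanSpace ℝ (Fin d) → ℝ)
    (hf_density : IsLebesgueDensity (ν : Measure (EuclideanSpace ℝ (Fin d))) f)
    (hf_usc : UpperSemicontinuous f)
    (hf_concave : IsSConcave s f)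
    (hfs_density : ∀ n, IsLebesgueDensity (νs n : Measure (EuclideanSpace ℝ (Fin d))) (fs n))
    (hfs_usc : ∀ n, UpperSemicontinuous (fs n))
    (hfs_concave : ∀ n, IsSConcave s (fs n))
    (hweak : Tendsto νs atTop (𝓝 ν))
    (S : Set (EuclideanSpace ℝ (Fin d))) (hS_closed : IsClosed S)
    (hS_cont : ∀ x ∈ S, ContinuousAt f x)
    (κ : ℝ) (hκ : κ < -1 / s) :
    Tendsto
      (fun n : ℕ => ⨆ x ∈ S, ENNReal.ofReal ((1 + ‖x‖) ^ κ * |fs n x - f x|))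
      atTop (𝓝 0) := by
  -- For `s > 0` passing to `-1` loses nothing, since `κ < -1 / s < 0 < 1`.
  obtain ⟨s', hs', hfc, hfsc, hκ'⟩ : ∃ s' < 0, IsSConcave s' f ∧ (∀ n, IsSConcave s' (fs n)) ∧
      κ < -1 / s' := by
    rcases hs.lt_or_gt with h | h
    · exact ⟨s, h, hf_concave, hfs_concave, hκ⟩
    · refine ⟨-1, by norm_num, hf_concave.neg_one h hf_density.nonneg,
        fun n => (hfs_concave n).neg_one h (hfs_density n).nonneg, hκ.trans ?_⟩
      rw [neg_div, show (-1 : ℝ) / -1 = 1 by norm_num]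
      exact (neg_neg_of_pos (one_div_pos.2 h)).trans one_pos
  rw [ENNReal.tendsto_nhds_zero]
  intro ε hε
  obtain ⟨δ, hδ0, hδ⟩ : ∃ δ : ℝ, 0 < δ ∧ ENNReal.ofReal δ ≤ ε := by
    rcases eq_or_ne ε ⊤ with rfl | htop
    · exact ⟨1, one_pos, le_top⟩
    · exact ⟨ε.toReal, ENNReal.toReal_pos hε.ne' htop, ENNReal.ofReal_toReal_le⟩
  filter_upwards [eventually_forall_weighted_abs_sub_le hs' hf_density hfc hf_usc hfs_density
    hfsc hweak hS_closed hS_cont hκ' hδ0] with n hn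
  exact iSup₂_le fun x hx => (ENNReal.ofReal_le_ofReal (hn x hx)).trans hδ
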